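/- Let $A\in M_n(\mathbb{R})$ and consider the linear time-invariant system $\dot x=Ax$ on $\mathbb{R}^n$; for $t\ge 0$ let $\varphi(t,x_0)$ denote its solution at time $t$ with initial condition $x(0)=x_0$. Let $K\subset\mathbb{R}^n$ be a compact set of positive Lebesgue measure (for instance a closed cube). For $T,\varepsilon>0$, a finite set $S\subset K$ is called $(T,\varepsilon)$-spanning if for every $x_0\in K$ there is $x\in S$ with $\|\varphi(t,x_0)-\varphi(t,x)\|_\infty<\varepsilon$ for all $t\in[0,T]$; let $s(T,\varepsilon)$ be the minimal cardinality of a $(T,\varepsilon)$-spanning set. Then the topological entropy $$h(A):=\lim_{\varepsilon\to 0^+}\ \limsup_{T\to\infty}\frac{\log s(T,\varepsilon)}{T}$$ exists and equals $$h(A)=\sum_{\lambda}\max\{0,\operatorname{Re}\lambda\},$$ where the sum is over the complex eigenvalues $\lambda$ of $A$, counted with algebraic multiplicity, and $\log$ is the natural logarithm. -/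

import Mathlib

open Filter Topology MeasureTheory

noncomputable section

/-- `φ t x₀` is, for `t ≥ 0`, the value at time `t` of a solution of `x' = f (t, x)`, `x 0 = x₀`
(one-sided derivative at `t = 0`). -/
def IsSolutionMap {E : Type*} [NormedAddCommGroup E] [NormedSpace ℝ E]
    (f : ℝ → E → E) (φ : ℝ → E → E) : Prop :=
  ∀ x₀ : E, φ 0 x₀ = x₀ ∧
    ∀ t : ℝ, 0 ≤ t →
      HasDerivWithinAt (fun s => φ s x₀) (f t (φ t x₀)) (Set.Ici 0) t

/-- The finite set `S` of initial conditions is `(T, ε)`-spanning for the initial set `K`. -/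
def IsSpanning {E : Type*} [NormedAddCommGroup E]
    (φ : ℝ → E → E) (K : Set E) (T ε : ℝ) (S : Finset E) : Prop :=
  (S : Set E) ⊆ K ∧
    ∀ x₀ ∈ K, ∃ x ∈ S, ∀ t ∈ Set.Icc 0 T, ‖φ t x₀ - φ t x‖ < ε

/-- The minimal cardinality `s(T, ε)` of a `(T, ε)`-spanning set (`⊤` if there is none). -/
def spanningCard {E : Type*} [NormedAddCommGroup E]
    (φ : ℝ → E → E) (K : Set E) (T ε : ℝ) : ℕ∞ :=
  ⨅ (S : Finset E) (_ : IsSpanning φ K T ε S), (S.card : ℕ∞)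

/-- `limsup_{T → ∞} log s(T, ε) / T`, as an extended real number. -/
def entropyAtScale {E : Type*} [NormedAddCommGroup E]
    (φ : ℝ → E → E) (K : Set E) (ε : ℝ) : EReal :=
  limsup (fun T : ℝ => ENNReal.log ((spanningCard φ K T ε : ℕ∞) : ENNReal) / (T : EReal)) atTop

/-- The limit `lim_{ε → 0⁺} limsup_{T → ∞} log s(T, ε) / T` defining the topological entropy
(with initial set `K`) exists and equals `h`. -/
def HasTopologicalEntropy {E : Type*} [NormedAddCommGroup E]
    (φ : ℝ → E → E) (K : Set E) (h : EReal) : Prop :=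
  Tendsto (fun ε : ℝ => entropyAtScale φ K ε) (𝓝[>] 0) (𝓝 h)

/-- `∑ max {0, Re λ}` over the complex eigenvalues of the real matrix `A`, counted with algebraic
multiplicity. -/
def unstableEigenvalueSum {n : ℕ} (A : Matrix (Fin n) (Fin n) ℝ) : ℝ :=
  ((A.map (algebraMap ℝ ℂ)).charpoly.roots.map fun z : ℂ => max 0 z.re).sum

end

/-!
For a linear flow `φ` the dynamical ball about a point is the translate of
`B T r = {x | ∀ t ∈ [0, T], ‖φ t x‖ ≤ r}`. Covering `K` by translates of `B T ε`, and packing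
translates of `B T r` with `2 * r < ε` into a thickening `K'` of `K`, gives
`vol K / vol (B T ε) ≤ s(T, ε) ≤ vol K' / vol (B T r)`, so the entropy is the exponential rate at
which `vol (B T r)` decays, whatever `r` is. To compute the rate, pass to the complexification:
`B T r ×ˢ B T r` is a dynamical ball of the doubled flow on `E × E`, which splits into generalized
eigenspaces. On the one for the eigenvalue `z` the flow expands norms by `exp (t * Re z)` up to a
subexponential factor, so the ball is comparable with a polydisc of radii
`exp (-max 0 (Re z) * T)`. Each complex dimension counts twice in the volume, and so does `B T r`.
-/

theorem tendsto_log_div_atTop_of_exp_bounds {v : ℝ → ℝ} {h : ℝ}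
    (hlower : ∀ a < h, ∃ C > 0, ∀ᶠ T in atTop, C * Real.exp (a * T) ≤ v T)
    (hupper : ∀ b > h, ∃ C, ∀ᶠ T in atTop, v T ≤ C * Real.exp (b * T)) :
    Tendsto (fun T => Real.log (v T) / T) atTop (𝓝 h) := by
  have hpos : ∀ᶠ T in atTop, 0 < v T := by
    obtain ⟨C, hC, hv⟩ := hlower (h - 1) (sub_one_lt h)
    exact hv.mono fun T hT => (by positivity : 0 < C * Real.exp ((h - 1) * T)).trans_le hT
  have hlim (C a : ℝ) : Tendsto (fun T : ℝ => C / T + a) atTop (𝓝 a) := by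
    simpa using (tendsto_const_nhds.div_atTop tendsto_id).add_const a
  have hlog {C a T : ℝ} (hC : 0 < C) (hT : 0 < T) :
      Real.log C / T + a = Real.log (C * Real.exp (a * T)) / T := by
    rw [Real.log_mul hC.ne' (Real.exp_pos _).ne', Real.log_exp]
    field_simp
  refine tendsto_order.2 ⟨fun a ha => ?_, fun b hb => ?_⟩
  · obtain ⟨a', haa', ha'⟩ := exists_between ha
    obtain ⟨C, hC, hv⟩ := hlower a' ha'
    filter_upwards [hv, (hlim (Real.log C) a').eventually_const_lt haa', eventually_gt_atTop 0]
      with T hvT haT hT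
    rw [hlog hC hT] at haT
    exact haT.trans_le (by gcongr)
  · obtain ⟨b', hb', hbb'⟩ := exists_between hb
    obtain ⟨C, hv⟩ := hupper b' hb'
    filter_upwards [hv, (hlim (Real.log C) b').eventually_lt_const hbb', eventually_gt_atTop 0,
      hpos] with T hvT hbT hT hvpos
    have hC : 0 < C := pos_of_mul_pos_left (hvpos.trans_le hvT) (Real.exp_pos _).le
    rw [hlog hC hT] at hbT
    exact lt_of_le_of_lt (by gcongr) hbT

theorem tendsto_ennrealLog_div_div_atTop {u : ℝ → ENNReal} {c : ENNReal} {h : ℝ}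
    (hc : c ≠ 0) (hc' : c ≠ ⊤) (hu : ∀ᶠ T in atTop, u T ≠ 0 ∧ u T ≠ ⊤)
    (hlim : Tendsto (fun T => Real.log (u T).toReal / T) atTop (𝓝 h)) :
    Tendsto (fun T : ℝ => ENNReal.log (c / u T) / (T : EReal)) atTop (𝓝 ((-h : ℝ) : EReal)) := by
  have hreal : Tendsto (fun T : ℝ => Real.log c.toReal / T - Real.log (u T).toReal / T) atTop
      (𝓝 (-h)) := by
    simpa using (tendsto_const_nhds.div_atTop tendsto_id).sub hlim
  refine ((continuous_coe_real_ereal.tendsto _).comp hreal).congr' ?_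
  filter_upwards [hu] with T ⟨hu0, hu_top⟩
  have hne : c / u T ≠ 0 := ENNReal.div_ne_zero.2 ⟨hc, hu_top⟩
  have hne' : c / u T ≠ ⊤ := ENNReal.div_ne_top hc' hu0
  rw [ENNReal.log_pos_real hne hne', ENNReal.toReal_div,
    Real.log_div (ENNReal.toReal_pos hc hc').ne' (ENNReal.toReal_pos hu0 hu_top).ne',
    ← EReal.coe_div, sub_div]
  rfl

section Translates

variable {G : Type*} [AddCommGroup G] [MeasurableSpace G] (μ : Measure G)
  [μ.IsAddLeftInvariant]

open scoped Pointwise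

theorem measure_finset_add_le (S : Finset G) (B : Set G) :
    μ (S + B) ≤ S.card * μ B := by
  rw [← vadd_eq_add, ← Set.iUnion_vadd_set]
  calc μ (⋃ x ∈ S, x +ᵥ B) ≤ ∑ x ∈ S, μ (x +ᵥ B) := measure_biUnion_finset_le S _
    _ = S.card * μ B := by simp only [measure_vadd, Finset.sum_const, nsmul_eq_mul]

theorem measure_finset_add_eq [MeasurableAdd G] {S : Finset G} {B : Set G}
    (hS : (S : Set G).PairwiseDisjoint (· +ᵥ B)) (hB : MeasurableSet B) :
    μ (S + B) = S.card * μ B := by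
  rw [← vadd_eq_add, ← Set.iUnion_vadd_set]
  calc μ (⋃ x ∈ S, x +ᵥ B) = ∑ x ∈ S, μ (x +ᵥ B) :=
        measure_biUnion_finset hS fun x _ => hB.const_vadd x
    _ = S.card * μ B := by simp only [measure_vadd, Finset.sum_const, nsmul_eq_mul]

end Translates

theorem exists_finset_isSeparated_isCover {X : Type*} {U : SetRel X X} [U.IsRefl] [U.IsSymm]
    {s : Set X} {N : ℕ} (hN : ∀ S : Finset X, ↑S ⊆ s → U.IsSeparated S → S.card ≤ N) :
    ∃ S : Finset X, ↑S ⊆ s ∧ U.IsSeparated S ∧ U.IsCover s S := by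
  classical
  have hfinite : (Finset.card '' {S : Finset X | ↑S ⊆ s ∧ U.IsSeparated S}).Finite :=
    (Set.finite_Iic N).subset (Set.image_subset_iff.2 fun S hS => hN S hS.1 hS.2)
  obtain ⟨S, ⟨hSs, hS⟩, hmax⟩ := hfinite.exists_maximalFor' Finset.card _ ⟨∅, by simp⟩
  refine ⟨S, hSs, hS, fun x hx => ?_⟩
  by_contra! hfar
  have hxS : x ∉ S := fun hxS => hfar x hxS (U.rfl)
  have hcard := hmax (j := insert x S)
    ⟨by simpa [Set.insert_subset_iff] using ⟨hx, hSs⟩,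
      by simpa using hS.insert fun y hy hxy => (hfar y hy hxy).elim⟩
  simp [Finset.card_insert_of_notMem hxS] at hcard

section Spanning

variable {E : Type*} [NormedAddCommGroup E] {φ : ℝ → E → E} {K : Set E} {T ε : ℝ}

theorem le_spanningCard {x : ENNReal} (h : ∀ S, IsSpanning φ K T ε S → x ≤ S.card) :
    x ≤ (spanningCard φ K T ε : ENNReal) := by
  rw [spanningCard, iInf_subtype']
  rcases isEmpty_or_nonempty {S : Finset E // IsSpanning φ K T ε S} with _ | _
  · simp
  · obtain ⟨S, hS⟩ := ENat.exists_eq_iInf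
      fun S : {S : Finset E // IsSpanning φ K T ε S} => (S.1.card : ℕ∞)
    rw [← hS]
    simpa using h S.1 S.2

theorem IsSpanning.spanningCard_le {S : Finset E} (hS : IsSpanning φ K T ε S) :
    (spanningCard φ K T ε : ENNReal) ≤ S.card := by
  have hcard : spanningCard φ K T ε ≤ S.card := iInf₂_le S hS
  simpa using ENat.toENNReal_le.2 hcard

theorem spanningCard_congr {ψ : ℝ → E → E} (h : ∀ t ∈ Set.Icc 0 T, φ t = ψ t) :
    spanningCard φ K T ε = spanningCard ψ K T ε := by
  have hiff (S : Finset E) : IsSpanning φ K T ε S ↔ IsSpanning ψ K T ε S := by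
    simp +contextual only [IsSpanning, h]
  simp only [spanningCard, hiff]

/-- The pairs of points whose orbits stay less than `ε` apart up to time `T`. -/
def dynamicalEntourage (φ : ℝ → E → E) (T ε : ℝ) : SetRel E E :=
  {p | ∀ t ∈ Set.Icc 0 T, ‖φ t p.1 - φ t p.2‖ < ε}

theorem isSpanning_iff_isCover {S : Finset E} :
    IsSpanning φ K T ε S ↔ ↑S ⊆ K ∧ (dynamicalEntourage φ T ε).IsCover K S :=
  Iff.rfl

theorem exists_isSpanning_isSeparated (hε : 0 < ε) {N : ℕ}
    (hN : ∀ S : Finset E, ↑S ⊆ K → (dynamicalEntourage φ T ε).IsSeparated S → S.card ≤ N) :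
    ∃ S : Finset E, IsSpanning φ K T ε S ∧ (dynamicalEntourage φ T ε).IsSeparated S := by
  have : (dynamicalEntourage φ T ε).IsRefl := ⟨fun x t _ => by simpa using hε⟩
  have : (dynamicalEntourage φ T ε).IsSymm :=
    ⟨fun x y hxy t ht => norm_sub_rev (φ t x) _ ▸ hxy t ht⟩
  obtain ⟨S, hSK, hS, hcover⟩ := exists_finset_isSeparated_isCover hN
  exact ⟨S, isSpanning_iff_isCover.2 ⟨hSK, hcover⟩, hS⟩

end Spanning

section DynamicalBall

open scoped Pointwise

variable {E F : Type*} [NormedAddCommGroup E] [NormedSpace ℝ E] [NormedAddCommGroup F]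
  [NormedSpace ℝ F] {φ : ℝ → E →L[ℝ] E} {K : Set E} {T r ε : ℝ}

/-- The closed dynamical (Bowen) ball of radius `r` and time horizon `T` about the origin. By
linearity of `φ t`, the dynamical ball about `x` is its translate by `x`. -/
def dynamicalBall (φ : ℝ → E →L[ℝ] E) (T r : ℝ) : Set E :=
  {x | ∀ t ∈ Set.Icc 0 T, ‖φ t x‖ ≤ r}

theorem isClosed_dynamicalBall : IsClosed (dynamicalBall φ T r) := by
  simp only [dynamicalBall, Set.ofPred_forall]
  exact isClosed_biInter fun t _ => isClosed_le (φ t).continuous.norm continuous_const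

theorem dynamicalBall_subset_closedBall (h0 : φ 0 = 1) (hT : 0 ≤ T) :
    dynamicalBall φ T r ⊆ Metric.closedBall 0 r := fun x hx => by
  simpa [h0] using hx 0 ⟨le_rfl, hT⟩

theorem dynamicalBall_mem_nhds_zero (hφ : ContinuousOn φ (Set.Icc 0 T)) (hr : 0 < r) :
    dynamicalBall φ T r ∈ 𝓝 0 := by
  obtain ⟨B, hB⟩ := isCompact_Icc.exists_bound_of_continuousOn hφ
  refine Filter.mem_of_superset (Metric.closedBall_mem_nhds 0 (by positivity : 0 < r / (|B| + 1)))
    fun x hx t ht => ?_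
  calc ‖φ t x‖ ≤ (|B| + 1) * (r / (|B| + 1)) :=
        (φ t).le_of_opNorm_le_of_le ((hB t ht).trans (by linarith [le_abs_self B]))
          (mem_closedBall_zero_iff.1 hx)
    _ = r := by field_simp

theorem dynamicalBall_prodMap (φ : ℝ → E →L[ℝ] E) (ψ : ℝ → F →L[ℝ] F) (T r : ℝ) :
    dynamicalBall (fun t => (φ t).prodMap (ψ t)) T r =
      dynamicalBall φ T r ×ˢ dynamicalBall ψ T r := by
  ext x
  simp [dynamicalBall, Prod.norm_def, imp_and, forall_and]

theorem IsSpanning.subset_add_dynamicalBall {S : Finset E}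
    (hS : IsSpanning (fun t => φ t) K T ε S) : K ⊆ S + dynamicalBall φ T ε := by
  intro x hx
  obtain ⟨y, hy, hxy⟩ := hS.2 x hx
  refine Set.mem_add.2 ⟨y, hy, x - y, fun t ht => ?_, add_sub_cancel y x⟩
  simpa only [map_sub] using (hxy t ht).le

theorem pairwiseDisjoint_vadd_dynamicalBall {S : Set E} (hr : 2 * r < ε)
    (hS : (dynamicalEntourage (fun t => φ t) T ε).IsSeparated S) :
    S.PairwiseDisjoint (· +ᵥ dynamicalBall φ T r) := by
  refine fun x hx y hy hxy => Set.disjoint_left.2 fun z hzx hzy => hS hx hy hxy fun t ht => ?_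
  have hzx' := Set.mem_vadd_set_iff_neg_vadd_mem.1 hzx t ht
  have hzy' := Set.mem_vadd_set_iff_neg_vadd_mem.1 hzy t ht
  rw [vadd_eq_add] at hzx' hzy'
  calc ‖φ t x - φ t y‖ = ‖φ t (-y + z) - φ t (-x + z)‖ := by
        simp only [map_add, map_neg]
        congr 1
        abel
    _ ≤ r + r := norm_sub_le_of_le hzy' hzx'
    _ < ε := by linarith

variable [MeasurableSpace E] (μ : Measure E)

theorem measure_dynamicalBall_ne_zero [μ.IsOpenPosMeasure] (hφ : ContinuousOn φ (Set.Icc 0 T))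
    (hr : 0 < r) : μ (dynamicalBall φ T r) ≠ 0 :=
  (μ.measure_pos_of_mem_nhds (dynamicalBall_mem_nhds_zero hφ hr)).ne'

theorem measure_dynamicalBall_ne_top [FiniteDimensional ℝ E] [IsFiniteMeasureOnCompacts μ]
    (h0 : φ 0 = 1) (hT : 0 ≤ T) : μ (dynamicalBall φ T r) ≠ ⊤ :=
  (Metric.isBounded_closedBall.subset (dynamicalBall_subset_closedBall h0 hT)).measure_lt_top.ne

theorem measure_div_le_spanningCard [μ.IsAddLeftInvariant] :
    μ K / μ (dynamicalBall φ T ε) ≤ (spanningCard (fun t => φ t) K T ε : ENNReal) :=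
  le_spanningCard fun S hS => ENNReal.div_le_of_le_mul <|
    (measure_mono hS.subset_add_dynamicalBall).trans (measure_finset_add_le μ S _)

variable [BorelSpace E] [FiniteDimensional ℝ E] [μ.IsAddHaarMeasure]

theorem card_le_measure_div (h0 : φ 0 = 1) (hφ : ContinuousOn φ (Set.Icc 0 T)) (hT : 0 ≤ T)
    (hr : 0 < r) (hrε : 2 * r < ε) {S : Finset E} (hSK : ↑S ⊆ K)
    (hS : (dynamicalEntourage (fun t => φ t) T ε).IsSeparated S) :
    S.card ≤ μ (Metric.cthickening r K) / μ (dynamicalBall φ T r) := by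
  rw [ENNReal.le_div_iff_mul_le (.inl (measure_dynamicalBall_ne_zero μ hφ hr))
    (.inl (measure_dynamicalBall_ne_top μ h0 hT)), ← measure_finset_add_eq μ
    (pairwiseDisjoint_vadd_dynamicalBall hrε hS) isClosed_dynamicalBall.measurableSet]
  refine measure_mono (Set.add_subset_iff.2 fun x hx y hy => ?_)
  refine Metric.mem_cthickening_of_dist_le _ x _ _ (hSK hx) ?_
  simpa using dynamicalBall_subset_closedBall h0 hT hy

theorem spanningCard_le_measure_div (h0 : φ 0 = 1) (hφ : ContinuousOn φ (Set.Icc 0 T))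
    (hT : 0 ≤ T) (hr : 0 < r) (hrε : 2 * r < ε) (hK : Bornology.IsBounded K) :
    (spanningCard (fun t => φ t) K T ε : ENNReal) ≤
      μ (Metric.cthickening r K) / μ (dynamicalBall φ T r) := by
  have hcard {S : Finset E} := card_le_measure_div μ h0 hφ hT hr hrε (K := K) (S := S)
  obtain ⟨N, hN⟩ := ENNReal.exists_nat_gt <| ENNReal.div_ne_top
    (hK.cthickening.measure_lt_top (μ := μ)).ne (measure_dynamicalBall_ne_zero μ hφ hr)
  obtain ⟨S, hS, hsep⟩ := exists_isSpanning_isSeparated (by linarith)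
    fun S hSK hS => Nat.cast_le.1 ((hcard hSK hS).trans hN.le)
  exact hS.spanningCard_le.trans (hcard hS.1 hsep)

theorem tendsto_log_spanningCard_div (h0 : φ 0 = 1) (hφ : Continuous φ)
    (hK : Bornology.IsBounded K) (hKpos : 0 < μ K) {h : ℝ}
    (hvol : ∀ r > 0, Tendsto (fun T => Real.log (μ.real (dynamicalBall φ T r)) / T) atTop (𝓝 (-h)))
    (hε : 0 < ε) :
    Tendsto (fun T : ℝ => ENNReal.log (spanningCard (fun t => φ t) K T ε : ENNReal) / (T : EReal))
      atTop (𝓝 (h : EReal)) := by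
  have hball (r : ℝ) (hr : 0 < r) :
      ∀ᶠ T in atTop, μ (dynamicalBall φ T r) ≠ 0 ∧ μ (dynamicalBall φ T r) ≠ ⊤ := by
    filter_upwards [eventually_ge_atTop 0] with T hT
    exact ⟨measure_dynamicalBall_ne_zero μ hφ.continuousOn hr, measure_dynamicalBall_ne_top μ h0 hT⟩
  have hratio (r : ℝ) (hr : 0 < r) {c : ENNReal} (hc : c ≠ 0) (hc' : c ≠ ⊤) :=
    neg_neg h ▸ tendsto_ennrealLog_div_div_atTop hc hc' (hball r hr) (hvol r hr)
  have hthick : 0 < μ (Metric.cthickening (ε / 3) K) :=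
    hKpos.trans_le (measure_mono (Metric.self_subset_cthickening K))
  refine tendsto_of_tendsto_of_tendsto_of_le_of_le'
    (hratio ε hε hKpos.ne' hK.measure_lt_top.ne)
    (hratio (ε / 3) (by positivity) hthick.ne' hK.cthickening.measure_lt_top.ne) ?_ ?_
  all_goals
    filter_upwards [eventually_ge_atTop 0] with T hT
    refine EReal.div_le_div_right_of_nonneg (EReal.coe_nonneg.2 hT) (ENNReal.log_le_log ?_)
  · exact measure_div_le_spanningCard μ
  · exact spanningCard_le_measure_div μ h0 hφ.continuousOn hT (by positivity) (by linarith) hK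

end DynamicalBall

section LyapunovSplitting

variable {E ι : Type*} {F : ι → Type*} [NormedAddCommGroup E] [NormedSpace ℝ E]
  [∀ i, NormedAddCommGroup (F i)] [∀ i, NormedSpace ℝ (F i)]
  {φ : ℝ → E →L[ℝ] E} {c : E ≃L[ℝ] ∀ i, F i} {ρ : ι → ℝ} {r δ : ℝ}

/-- The polydisc of polyradius `d` about the origin with respect to the splitting `c` of `E`. -/
def polydisc (c : E ≃L[ℝ] ∀ i, F i) (d : ι → ℝ) : Set E :=
  {x | ∀ i, ‖c x i‖ ≤ d i}

/-- The splitting `c` of `E` is respected by `φ`, and along its `i`-th summand `φ` has the exact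
Lyapunov exponent `ρ i`: up to a subexponential factor, uniform in the initial condition, it scales
norms by `exp (ρ i * t)` as `t → ∞`. -/
def IsLyapunovSplitting (φ : ℝ → E →L[ℝ] E) (c : E ≃L[ℝ] ∀ i, F i) (ρ : ι → ℝ) : Prop :=
  ∀ δ > 0, ∃ C > 0, ∀ t ≥ 0, ∀ x i,
    ‖c (φ t x) i‖ ≤ C * Real.exp ((ρ i + δ) * t) * ‖c x i‖ ∧
      ‖c x i‖ ≤ C * Real.exp ((-ρ i + δ) * t) * ‖c (φ t x) i‖

theorem exists_measure_polydisc [Fintype ι] [∀ i, FiniteDimensional ℝ (F i)]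
    [MeasurableSpace E] [BorelSpace E] (μ : Measure E) [μ.IsAddHaarMeasure] (c : E ≃L[ℝ] ∀ i, F i) :
    ∃ κ > 0, ∀ d : ι → ℝ, (∀ i, 0 ≤ d i) →
      μ (polydisc c d) = ENNReal.ofReal (κ * ∏ i, d i ^ Module.finrank ℝ (F i)) := by
  let (i : ι) : MeasurableSpace (F i) := borel (F i)
  have (i : ι) : BorelSpace (F i) := ⟨rfl⟩
  let ν : Measure (∀ i, F i) := Measure.pi fun _ => Measure.addHaar
  have : (μ.map c).IsAddHaarMeasure := c.isAddHaarMeasure_map μ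
  let s := (μ.map c).addHaarScalarFactor ν
  have hs : 0 < s := Measure.addHaarScalarFactor_pos_of_isAddHaarMeasure _ _
  let β (i : ι) : ℝ := Measure.addHaar.real (Metric.ball (0 : F i) 1)
  have hβ (i : ι) : 0 < β i :=
    ENNReal.toReal_pos (Metric.measure_ball_pos _ _ one_pos).ne' measure_ball_lt_top.ne
  refine ⟨s * ∏ i, β i, mul_pos hs (Finset.prod_pos fun i _ => hβ i), fun d hd => ?_⟩
  have hpreimage : polydisc c d = c ⁻¹' Set.univ.pi fun i => Metric.closedBall 0 (d i) := by
    ext x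
    simp [polydisc]
  have hball (i : ι) : Measure.addHaar (Metric.closedBall (0 : F i) (d i)) =
      ENNReal.ofReal (β i * d i ^ Module.finrank ℝ (F i)) := by
    rw [Measure.addHaar_closedBall _ _ (hd i), mul_comm, ENNReal.ofReal_mul (hβ i).le,
      ofReal_measureReal measure_ball_lt_top.ne]
  rw [hpreimage, ← Measure.map_apply c.continuous.measurable
    (.univ_pi fun i => Metric.isClosed_closedBall.measurableSet),
    Measure.isAddLeftInvariant_eq_smul (μ.map c) ν, Measure.smul_apply, Measure.pi_pi]
  simp only [hball]
  rw [← ENNReal.ofReal_prod_of_nonneg fun i _ => mul_nonneg (hβ i).le (pow_nonneg (hd i) _),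
    ENNReal.smul_def, smul_eq_mul, ← ENNReal.ofReal_coe_nnreal, ← ENNReal.ofReal_mul s.coe_nonneg,
    Finset.prod_mul_distrib, mul_assoc]

namespace IsLyapunovSplitting

theorem exists_dynamicalBall_subset_polydisc [Finite ι] (h : IsLyapunovSplitting φ c ρ)
    (hδ : 0 < δ) (hr : 0 < r) : ∃ R ≥ 0, ∀ T ≥ 0, dynamicalBall φ T r ⊆
      polydisc c fun i => R * Real.exp ((-max 0 (ρ i) + δ) * T) := by
  have := Fintype.ofFinite ι
  obtain ⟨C, hC, hbound⟩ := h δ hδ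
  refine ⟨C * (‖(c : E →L[ℝ] ∀ i, F i)‖ * r), by positivity, fun T hT x hx i => ?_⟩
  have hcoord {t : ℝ} (ht : t ∈ Set.Icc 0 T) :
      ‖c x i‖ ≤ C * Real.exp ((-ρ i + δ) * t) * (‖(c : E →L[ℝ] ∀ i, F i)‖ * r) := by
    refine (hbound t ht.1 x i).2.trans ?_
    gcongr
    exact (norm_le_pi_norm _ i).trans
      ((c : E →L[ℝ] ∀ i, F i).le_opNorm_of_le (hx t ht))
  change ‖c x i‖ ≤ C * _ * _
  rw [mul_right_comm]
  rcases le_total (ρ i) 0 with hρ | hρ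
  · refine (hcoord ⟨le_rfl, hT⟩).trans ?_
    rw [max_eq_left hρ]
    gcongr C * Real.exp ?_ * _
    simpa only [mul_zero, neg_zero, zero_add] using mul_nonneg hδ.le hT
  · rw [max_eq_right hρ]
    exact hcoord ⟨hT, le_rfl⟩

theorem exists_polydisc_subset_dynamicalBall [Finite ι] (h : IsLyapunovSplitting φ c ρ)
    (hδ : 0 < δ) (hr : 0 < r) : ∃ R > 0, ∀ T ≥ 0,
      (polydisc c fun i => R * Real.exp ((-max 0 (ρ i) + -δ) * T)) ⊆ dynamicalBall φ T r := by
  have := Fintype.ofFinite ι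
  obtain ⟨C, hC, hbound⟩ := h δ hδ
  set k := ‖(c.symm : (∀ i, F i) →L[ℝ] E)‖ + 1 with hk
  refine ⟨r / (k * C), by positivity, fun T _ x hx t ht => ?_⟩
  have hcoord (i : ι) : ‖c (φ t x) i‖ ≤ r / k := by
    have hexp : (ρ i + δ) * t + (-max 0 (ρ i) - δ) * T ≤ 0 := by
      have := mul_le_mul (add_le_add_left (le_max_right 0 (ρ i)) δ) ht.2 ht.1 (by positivity)
      linarith
    calc ‖c (φ t x) i‖
        ≤ C * Real.exp ((ρ i + δ) * t) * (r / (k * C) * Real.exp ((-max 0 (ρ i) + -δ) * T)) :=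
          (hbound t ht.1 x i).1.trans (by gcongr; exact hx i)
      _ = r / k * Real.exp ((ρ i + δ) * t + (-max 0 (ρ i) + -δ) * T) := by
          rw [Real.exp_add]
          field_simp
      _ ≤ r / k := mul_le_of_le_one_right (by positivity) (Real.exp_le_one_iff.2 hexp)
  calc ‖φ t x‖ = ‖c.symm (c (φ t x))‖ := by rw [c.symm_apply_apply]
    _ ≤ k * (r / k) := (c.symm : (∀ i, F i) →L[ℝ] E).le_of_opNorm_le_of_le (by simp [hk])
        ((pi_norm_le_iff_of_nonneg (by positivity)).2 hcoord)
    _ = r := mul_div_cancel₀ r (by positivity)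

end IsLyapunovSplitting

variable [Fintype ι]

theorem prod_const_mul_exp_pow (R T : ℝ) (a : ι → ℝ) (n : ι → ℕ) :
    ∏ i, (R * Real.exp (a i * T)) ^ n i =
      R ^ (∑ i, n i) * Real.exp ((∑ i, n i * a i) * T) := by
  simp only [mul_pow, Finset.prod_mul_distrib, Finset.prod_pow_eq_pow_sum, ← Real.exp_nat_mul,
    ← Real.exp_sum, Finset.sum_mul, mul_assoc]

variable [∀ i, FiniteDimensional ℝ (F i)] [MeasurableSpace E] [BorelSpace E]

theorem exists_measure_polydisc_exp (μ : Measure E) [μ.IsAddHaarMeasure]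
    (c : E ≃L[ℝ] ∀ i, F i) (m : ι → ℝ) :
    ∃ κ > 0, ∀ R ≥ 0, ∀ δ T : ℝ, μ (polydisc c fun i => R * Real.exp ((-m i + δ) * T)) =
      ENNReal.ofReal (κ * R ^ (∑ i, Module.finrank ℝ (F i)) * Real.exp
        ((-∑ i, Module.finrank ℝ (F i) * m i + (∑ i, Module.finrank ℝ (F i) : ℕ) * δ) * T)) := by
  obtain ⟨κ, hκ, hmeasure⟩ := exists_measure_polydisc μ c
  refine ⟨κ, hκ, fun R hR δ T => ?_⟩
  rw [hmeasure _ fun i => by positivity, prod_const_mul_exp_pow, mul_assoc]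
  simp only [mul_add, mul_neg, Finset.sum_add_distrib, Finset.sum_neg_distrib, Finset.sum_mul,
    Nat.cast_sum]

namespace IsLyapunovSplitting

theorem exists_measure_dynamicalBall_le (h : IsLyapunovSplitting φ c ρ) (μ : Measure E)
    [μ.IsAddHaarMeasure] (hr : 0 < r) {b : ℝ}
    (hb : -∑ i, Module.finrank ℝ (F i) * max 0 (ρ i) < b) :
    ∃ C ≥ 0, ∀ T ≥ 0, μ (dynamicalBall φ T r) ≤ ENNReal.ofReal (C * Real.exp (b * T)) := by
  obtain ⟨κ, hκ, hmeasure⟩ := exists_measure_polydisc_exp μ c fun i => max 0 (ρ i)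
  obtain ⟨δ, hδ, hδb⟩ := exists_pos_mul_lt (sub_pos.2 hb) (∑ i, Module.finrank ℝ (F i) : ℕ)
  obtain ⟨R, hR, hsub⟩ := h.exists_dynamicalBall_subset_polydisc hδ hr
  refine ⟨κ * R ^ ∑ i, Module.finrank ℝ (F i), by positivity, fun T hT => ?_⟩
  refine (measure_mono (hsub T hT)).trans ?_
  rw [hmeasure R hR]
  gcongr
  linarith

theorem exists_le_measure_dynamicalBall (h : IsLyapunovSplitting φ c ρ) (μ : Measure E)
    [μ.IsAddHaarMeasure] (hr : 0 < r) {a : ℝ}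
    (ha : a < -∑ i, Module.finrank ℝ (F i) * max 0 (ρ i)) :
    ∃ C > 0, ∀ T ≥ 0, ENNReal.ofReal (C * Real.exp (a * T)) ≤ μ (dynamicalBall φ T r) := by
  obtain ⟨κ, hκ, hmeasure⟩ := exists_measure_polydisc_exp μ c fun i => max 0 (ρ i)
  obtain ⟨δ, hδ, hδa⟩ := exists_pos_mul_lt (sub_pos.2 ha) (∑ i, Module.finrank ℝ (F i) : ℕ)
  obtain ⟨R, hR, hsub⟩ := h.exists_polydisc_subset_dynamicalBall hδ hr
  refine ⟨κ * R ^ ∑ i, Module.finrank ℝ (F i), by positivity, fun T hT => ?_⟩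
  refine le_trans ?_ (measure_mono (hsub T hT))
  rw [hmeasure R hR.le]
  gcongr
  linarith

theorem tendsto_log_measureReal_dynamicalBall (h : IsLyapunovSplitting φ c ρ) (μ : Measure E)
    [μ.IsAddHaarMeasure] (hr : 0 < r) :
    Tendsto (fun T => Real.log (μ.real (dynamicalBall φ T r)) / T) atTop
      (𝓝 (-∑ i, Module.finrank ℝ (F i) * max 0 (ρ i))) := by
  refine tendsto_log_div_atTop_of_exp_bounds (fun a ha => ?_) (fun b hb => ?_)
  · obtain ⟨C, hC, hlower⟩ := h.exists_le_measure_dynamicalBall μ hr ha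
    obtain ⟨C', -, hupper⟩ := h.exists_measure_dynamicalBall_le μ hr (lt_add_one _)
    refine ⟨C, hC, (eventually_ge_atTop 0).mono fun T hT => ?_⟩
    exact (ENNReal.ofReal_le_iff_le_toReal
      ((hupper T hT).trans_lt ENNReal.ofReal_lt_top).ne).1 (hlower T hT)
  · obtain ⟨C, hC, hupper⟩ := h.exists_measure_dynamicalBall_le μ hr hb
    exact ⟨C, (eventually_ge_atTop 0).mono fun T hT =>
      ENNReal.toReal_le_of_le_ofReal (by positivity) (hupper T hT)⟩

end IsLyapunovSplitting

end LyapunovSplitting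

section Exponential

theorem eq_exp_smul_apply_of_hasDerivWithinAt {E : Type*} [NormedAddCommGroup E]
    [NormedSpace ℝ E] [CompleteSpace E] (L : E →L[ℝ] E) {z : ℝ → E}
    (hz : ∀ t, 0 ≤ t → HasDerivWithinAt z (L (z t)) (Set.Ici 0) t) {t : ℝ} (ht : 0 ≤ t) :
    z t = NormedSpace.exp (t • L) (z 0) := by
  let w (s : ℝ) : E := NormedSpace.exp (s • L) (z 0)
  have hw (s : ℝ) : HasDerivAt w (L (w s)) s :=
    (ContinuousLinearMap.apply ℝ E (z 0)).hasFDerivAt.comp_hasDerivAt _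
      (hasDerivAt_exp_smul_const' L s)
  refine ODE_solution_unique_of_mem_Icc_right (v := fun _ => L) (s := fun _ => Set.univ)
    (K := ‖L‖₊) (a := 0) (b := t) (f := z) (g := w) (fun _ _ => L.lipschitz.lipschitzOnWith)
    (fun s hs => ((hz s hs.1).continuousWithinAt).mono Set.Icc_subset_Ici_self)
    (fun s hs => (hz s hs.1).mono (Set.Ici_subset_Ici.2 hs.1)) (fun _ _ => trivial)
    (fun s _ => (hw s).continuousAt.continuousWithinAt) (fun s _ => (hw s).hasDerivWithinAt)
    (fun _ _ => trivial) ?_ ⟨ht, le_rfl⟩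
  simp [w]

theorem semiconj_exp {𝕜 𝕜' E F : Type*} [RCLike 𝕜] [RCLike 𝕜'] [NormedAddCommGroup E]
    [NormedSpace 𝕜 E] [CompleteSpace E] [NormedAddCommGroup F] [NormedSpace 𝕜' F]
    [CompleteSpace F] {L : E →L[𝕜] E} {M : F →L[𝕜'] F} {J : E →+ F} (hJ : Continuous J)
    (h : Function.Semiconj J L M) :
    Function.Semiconj J ⇑(NormedSpace.exp L) ⇑(NormedSpace.exp M) := by
  intro x
  have hL := ((NormedSpace.exp_series_hasSum_exp' (𝕂 := 𝕜) L).mapL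
    (ContinuousLinearMap.apply 𝕜 E x)).map J hJ
  have hM := (NormedSpace.exp_series_hasSum_exp' (𝕂 := 𝕜') M).mapL
    (ContinuousLinearMap.apply 𝕜' F (J x))
  refine hL.unique (hM.congr_fun fun n => ?_)
  change J ((n.factorial : 𝕜)⁻¹ • (L ^ n) x) = (n.factorial : 𝕜')⁻¹ • (M ^ n) (J x)
  rw [map_inv_natCast_smul J 𝕜 𝕜', pow_apply_eq_iterate, pow_apply_eq_iterate, h.iterate_right n x]

theorem exp_prodMap {𝕜 E F : Type*} [RCLike 𝕜] [NormedAddCommGroup E] [NormedSpace 𝕜 E]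
    [CompleteSpace E] [NormedAddCommGroup F] [NormedSpace 𝕜 F] [CompleteSpace F]
    (L : E →L[𝕜] E) (M : F →L[𝕜] F) :
    NormedSpace.exp (L.prodMap M) = (NormedSpace.exp L).prodMap (NormedSpace.exp M) :=
  ContinuousLinearMap.ext fun x => Prod.ext
    (semiconj_exp (J := AddMonoidHom.fst E F) continuous_fst (fun _ => rfl) x)
    (semiconj_exp (J := AddMonoidHom.snd E F) continuous_snd (fun _ => rfl) x)

section Nilpotent

variable {𝔸 : Type*} [NormedRing 𝔸] [NormedAlgebra ℂ 𝔸]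

theorem exp_smul_eq_sum_of_pow_eq_zero {N : 𝔸} {k : ℕ} (hN : N ^ k = 0) (z : ℂ) :
    NormedSpace.exp (z • N) = ∑ m ∈ Finset.range k, (z ^ m / m.factorial) • N ^ m := by
  rw [NormedSpace.exp_eq_tsum ℂ]
  refine (tsum_eq_sum fun m hm => ?_).trans (Finset.sum_congr rfl fun m _ => ?_)
  · rw [smul_pow, pow_eq_zero_of_le (not_lt.1 (mt Finset.mem_range.2 hm)) hN, smul_zero, smul_zero]
  · rw [smul_pow, smul_smul, inv_mul_eq_div]

theorem exists_norm_exp_smul_le_of_isNilpotent {N : 𝔸} (hN : IsNilpotent N) {δ : ℝ}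
    (hδ : 0 < δ) : ∃ C > 0, ∀ t : ℝ,
      ‖NormedSpace.exp ((t : ℂ) • N)‖ ≤ C * Real.exp (δ * |t|) := by
  obtain ⟨k, hk⟩ := hN
  refine ⟨∑ m ∈ Finset.range k, ‖N ^ m‖ / δ ^ m + 1, by positivity, fun t => ?_⟩
  have hterm (m : ℕ) : ‖((t : ℂ) ^ m / m.factorial) • N ^ m‖ ≤
      ‖N ^ m‖ / δ ^ m * Real.exp (δ * |t|) := by
    calc ‖((t : ℂ) ^ m / m.factorial) • N ^ m‖
        = ‖N ^ m‖ / δ ^ m * ((δ * |t|) ^ m / m.factorial) := by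
          rw [norm_smul, norm_div, norm_pow, Complex.norm_real, Complex.norm_natCast,
            Real.norm_eq_abs, mul_pow]
          field_simp
      _ ≤ ‖N ^ m‖ / δ ^ m * Real.exp (δ * |t|) := by
          gcongr
          exact Real.pow_div_factorial_le_exp _ (by positivity) m
  rw [exp_smul_eq_sum_of_pow_eq_zero hk, add_mul, Finset.sum_mul]
  exact (norm_sum_le_of_le _ fun m _ => hterm m).trans (le_add_of_nonneg_right (by positivity))

theorem exists_norm_exp_smul_le_of_isNilpotent_sub [CompleteSpace 𝔸] {a : 𝔸} {μ : ℂ}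
    (ha : IsNilpotent (a - algebraMap ℂ 𝔸 μ)) {δ : ℝ} (hδ : 0 < δ) :
    ∃ C > 0, ∀ t : ℝ,
      ‖NormedSpace.exp ((t : ℂ) • a)‖ ≤ C * Real.exp (μ.re * t + δ * |t|) := by
  obtain ⟨C, hC, hbound⟩ := exists_norm_exp_smul_le_of_isNilpotent ha hδ
  refine ⟨C, hC, fun t => ?_⟩
  have : NormedAlgebra ℚ 𝔸 := NormedAlgebra.restrictScalars ℚ ℂ 𝔸
  have hsplit : (t : ℂ) • a =
      algebraMap ℂ 𝔸 (t * μ) + (t : ℂ) • (a - algebraMap ℂ 𝔸 μ) := by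
    rw [map_mul, ← Algebra.smul_def, ← smul_add, add_sub_cancel]
  rw [hsplit, NormedSpace.exp_add_of_commute (Algebra.commutes _ _),
    ← NormedSpace.algebraMap_exp_comm, ← Complex.exp_eq_exp_ℂ, ← Algebra.smul_def, norm_smul,
    Complex.norm_exp, Complex.re_ofReal_mul, mul_comm t, Real.exp_add, mul_left_comm]
  gcongr
  exact hbound t

end Nilpotent

end Exponential

section GeneralizedEigenspaces

theorem exists_norm_exp_smul_apply_le {W : Type*} [NormedAddCommGroup W] [NormedSpace ℂ W]
    [CompleteSpace W] {M : W →L[ℂ] W} {μ : ℂ}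
    (hM : IsNilpotent (M - algebraMap ℂ (W →L[ℂ] W) μ)) {δ : ℝ} (hδ : 0 < δ) :
    ∃ C > 0, ∀ t : ℝ, 0 ≤ t → ∀ y : W,
      ‖NormedSpace.exp ((t : ℂ) • M) y‖ ≤ C * Real.exp ((μ.re + δ) * t) * ‖y‖ ∧
        ‖y‖ ≤ C * Real.exp ((-μ.re + δ) * t) * ‖NormedSpace.exp ((t : ℂ) • M) y‖ := by
  obtain ⟨C, hC, hbound⟩ := exists_norm_exp_smul_le_of_isNilpotent_sub hM hδ
  have : NormedAlgebra ℚ (W →L[ℂ] W) := NormedAlgebra.restrictScalars ℚ ℂ _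
  refine ⟨C, hC, fun t ht y => ⟨?_, ?_⟩⟩
  · refine ContinuousLinearMap.le_of_opNorm_le _ ?_ y
    simpa only [abs_of_nonneg ht, ← add_mul] using hbound t
  · have hinv : NormedSpace.exp (((-t : ℝ) : ℂ) • M) * NormedSpace.exp ((t : ℂ) • M) = 1 := by
      rw [← NormedSpace.exp_add_of_commute ((Commute.refl M).smul_left _ |>.smul_right _),
        ← add_smul, Complex.ofReal_neg, neg_add_cancel, zero_smul, NormedSpace.exp_zero]
    calc ‖y‖ = ‖NormedSpace.exp (((-t : ℝ) : ℂ) • M) (NormedSpace.exp ((t : ℂ) • M) y)‖ := by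
          rw [← mul_apply_eq_comp, hinv, one_apply_eq_self]
      _ ≤ C * Real.exp ((-μ.re + δ) * t) * ‖NormedSpace.exp ((t : ℂ) • M) y‖ := by
          refine ContinuousLinearMap.le_of_opNorm_le _ ?_ _
          simpa only [abs_neg, abs_of_nonneg ht, mul_neg, ← neg_mul, ← add_mul] using hbound (-t)

theorem isLyapunovSplitting_exp_smul {E ι : Type*} {W : ι → Type*} [Finite ι]
    [NormedAddCommGroup E] [NormedSpace ℝ E] [CompleteSpace E] [∀ i, NormedAddCommGroup (W i)]
    [∀ i, NormedSpace ℂ (W i)] [∀ i, CompleteSpace (W i)] {L : E →L[ℝ] E}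
    {M : ∀ i, W i →L[ℂ] W i} {c : E ≃L[ℝ] ∀ i, W i} {μ : ι → ℂ}
    (hc : ∀ i, Function.Semiconj (fun x => c x i) L (M i))
    (hM : ∀ i, IsNilpotent (M i - algebraMap ℂ (W i →L[ℂ] W i) (μ i))) :
    IsLyapunovSplitting (fun t => NormedSpace.exp (t • L)) c fun i => (μ i).re := by
  have := Fintype.ofFinite ι
  intro δ hδ
  choose C hC hbound using fun i => exists_norm_exp_smul_apply_le (hM i) hδ
  have hexp (t : ℝ) (x : E) (i : ι) :
      c (NormedSpace.exp (t • L) x) i = NormedSpace.exp ((t : ℂ) • M i) (c x i) := by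
    refine semiconj_exp (L := t • L) (M := (t : ℂ) • M i)
      (J := (Pi.evalAddMonoidHom W i).comp (c : E →+ ∀ i, W i))
      ((continuous_apply i).comp c.continuous) (fun x => ?_) x
    change c (t • L x) i = (t : ℂ) • M i (c x i)
    rw [map_smul, Pi.smul_apply, ← (hc i).eq x]
    rfl
  have hCsum (i : ι) : C i ≤ ∑ j, C j + 1 :=
    (Finset.single_le_sum (fun j _ => (hC j).le) (Finset.mem_univ i)).trans
      (le_add_of_nonneg_right zero_le_one)
  refine ⟨∑ j, C j + 1, add_pos_of_nonneg_of_pos (Finset.sum_nonneg fun j _ => (hC j).le) one_pos,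
    fun t ht x i => ?_⟩
  obtain ⟨hgrowth, hdecay⟩ := hbound i t ht (c x i)
  simp only [hexp]
  exact ⟨hgrowth.trans (by gcongr; exact hCsum i), hdecay.trans (by gcongr; exact hCsum i)⟩

section DirectSum

variable {R V ι : Type*} [Ring R] [AddCommGroup V] [Module R V] [Fintype ι] [DecidableEq ι]
  {p : ι → Submodule R V} (hind : iSupIndep p) (htop : ⨆ i, p i = ⊤)

/-- The components of a vector of `V` with respect to the decomposition of `V` as the internal
direct sum of finitely many submodules `p i`. -/
noncomputable def directSumComponents : V ≃ₗ[R] ∀ i, p i :=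
  (hind.linearEquiv htop).symm ≪≫ₗ DFinsupp.linearEquivFunOnFintype

theorem directSumComponents_symm_apply (y : ∀ i, p i) :
    (directSumComponents hind htop).symm y = ∑ i, (y i : V) := by
  classical
  simp [directSumComponents, DFinsupp.sumAddHom_apply, DFinsupp.sum_eq_sum_fintype]
  rfl

theorem directSumComponents_map {f : Module.End R V} (hf : ∀ i, Set.MapsTo f (p i) (p i))
    (x : V) (i : ι) :
    directSumComponents hind htop (f x) i =
      f.restrict (hf i) (directSumComponents hind htop x i) := by
  obtain ⟨y, rfl⟩ := (directSumComponents hind htop).symm.surjective x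
  have hmap : f ((directSumComponents hind htop).symm y) =
      (directSumComponents hind htop).symm fun i => f.restrict (hf i) (y i) := by
    rw [directSumComponents_symm_apply, directSumComponents_symm_apply, map_sum]
    rfl
  rw [hmap, LinearEquiv.apply_symm_apply, LinearEquiv.apply_symm_apply]

end DirectSum

/-- `∑ max {0, Re z}` over the complex roots `z` of `p`, counted with multiplicity. -/
noncomputable def unstableRootSum (p : Polynomial ℂ) : ℝ :=
  (p.roots.map fun z => max 0 z.re).sum

theorem unstableRootSum_eq_sum_rootMultiplicity (p : Polynomial ℂ) :
    unstableRootSum p = ∑ z ∈ p.roots.toFinset, p.rootMultiplicity z * max 0 z.re := by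
  simp only [unstableRootSum, Finset.sum_multiset_map_count, Polynomial.count_roots,
    nsmul_eq_mul]

theorem iSup_maxGenEigenspace_roots_charpoly {K V : Type*} [Field K] [IsAlgClosed K]
    [DecidableEq K] [AddCommGroup V] [Module K V] [FiniteDimensional K V] (f : Module.End K V) :
    ⨆ z : f.charpoly.roots.toFinset, f.maxGenEigenspace z = ⊤ := by
  rw [← f.iSup_maxGenEigenspace_eq_top, iSup_subtype]
  refine iSup_congr fun z => le_antisymm (iSup_le fun _ => le_rfl) ?_
  by_cases hz : z ∈ f.charpoly.roots.toFinset
  · exact le_iSup_of_le hz le_rfl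
  · have hbot : f.maxGenEigenspace z = ⊥ := by
      rw [← Submodule.finrank_eq_zero, f.finrank_maxGenEigenspace_eq, ← Polynomial.count_roots,
        Multiset.count_eq_zero]
      exact mt Multiset.mem_toFinset.2 hz
    exact hbot ▸ bot_le

theorem tendsto_log_measureReal_dynamicalBall_of_semiconj {E V : Type*} [NormedAddCommGroup E]
    [NormedSpace ℝ E] [MeasurableSpace E] [BorelSpace E] [NormedAddCommGroup V]
    [NormedSpace ℂ V] [FiniteDimensional ℂ V] {L : E →L[ℝ] E} {f : Module.End ℂ V}
    {e : E ≃L[ℝ] V} (he : Function.Semiconj e L f) (μ : Measure E) [μ.IsAddHaarMeasure]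
    {r : ℝ} (hr : 0 < r) :
    Tendsto (fun T => Real.log
      (μ.real (dynamicalBall (fun t => NormedSpace.exp (t • L)) T r)) / T) atTop
      (𝓝 (-(2 * unstableRootSum f.charpoly))) := by
  classical
  have hmaps (z : f.charpoly.roots.toFinset) :
      Set.MapsTo f (f.maxGenEigenspace z) (f.maxGenEigenspace z) :=
    f.mapsTo_maxGenEigenspace_of_comm rfl z
  let components := directSumComponents
    (f.independent_maxGenEigenspace.comp Subtype.val_injective)
    (iSup_maxGenEigenspace_roots_charpoly f)
  let c : E ≃L[ℝ] ∀ z : f.charpoly.roots.toFinset, f.maxGenEigenspace z :=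
    e.trans (components.restrictScalars ℝ).toContinuousLinearEquiv
  let M (z : f.charpoly.roots.toFinset) :=
    Module.End.toContinuousLinearMap (f.maxGenEigenspace z) (f.restrict (hmaps z))
  have hnilpotent (z : f.charpoly.roots.toFinset) :
      IsNilpotent (M z - algebraMap ℂ _ (z : ℂ)) := by
    rw [← (Module.End.toContinuousLinearMap (f.maxGenEigenspace z)).commutes, ← map_sub]
    exact (f.isNilpotent_restrict_maxGenEigenspace_sub_algebraMap z).map _
  have := FiniteDimensional.complete ℂ V
  have : CompleteSpace E :=
    (completeSpace_congr (e := e.toEquiv) e.isUniformEmbedding).2 inferInstance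
  have hsplitting : IsLyapunovSplitting (fun t => NormedSpace.exp (t • L)) c
      fun z => (z : ℂ).re := by
    refine isLyapunovSplitting_exp_smul (fun z x => ?_) hnilpotent
    change components (e (L x)) z = _
    rw [he x]
    exact directSumComponents_map _ _ hmaps _ _
  convert hsplitting.tendsto_log_measureReal_dynamicalBall μ hr using 2
  rw [unstableRootSum_eq_sum_rootMultiplicity, ← Finset.sum_coe_sort, Finset.mul_sum]
  simp only [finrank_real_of_complex, LinearMap.finrank_maxGenEigenspace_eq, Nat.cast_mul,
    Nat.cast_ofNat, mul_assoc]

end GeneralizedEigenspaces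

section Complexification

theorem charpoly_toLin'_map_toMatrix {k F V ι : Type*} [Field k] [Field F] [Algebra k F]
    [AddCommGroup V] [Module k V] [FiniteDimensional k V] [Fintype ι] [DecidableEq ι]
    (b : Module.Basis ι k V) (f : Module.End k V) :
    LinearMap.charpoly (Matrix.toLin' ((LinearMap.toMatrix b b f).map (algebraMap k F))) =
      f.charpoly.map (algebraMap k F) := by
  rw [Matrix.charpoly_toLin', Matrix.charpoly_map, LinearMap.charpoly_toMatrix]

variable {E ι : Type*} [NormedAddCommGroup E] [NormedSpace ℝ E] [FiniteDimensional ℝ E]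

/-- The complex coordinates of `x + i y` for `(x, y)` in `E × E`, regarded as the complexification
of `E`, with respect to a real basis of `E`. -/
noncomputable def complexCoordinates [Fintype ι] (b : Module.Basis ι ℝ E) : (E × E) ≃L[ℝ] (ι → ℂ) :=
  LinearEquiv.toContinuousLinearEquiv
    { toFun := fun p i => ⟨b.repr p.1 i, b.repr p.2 i⟩
      invFun := fun z => (b.equivFun.symm fun i => (z i).re, b.equivFun.symm fun i => (z i).im)
      map_add' := fun p q => funext fun i => Complex.ext (by simp) (by simp)
      map_smul' := fun a p => funext fun i => Complex.ext (by simp) (by simp)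
      left_inv := fun p => by simp
      right_inv := fun z => funext fun i => Complex.ext
        (congrFun (b.equivFun.apply_symm_apply _) i) (congrFun (b.equivFun.apply_symm_apply _) i) }

theorem complexCoordinates_semiconj [Fintype ι] [DecidableEq ι] (b : Module.Basis ι ℝ E)
    (L : E →L[ℝ] E) :
    Function.Semiconj (complexCoordinates b) (L.prodMap L)
      (Matrix.toLin' ((LinearMap.toMatrix b b L).map (algebraMap ℝ ℂ))) := by
  have hrepr (x : E) (i : ι) :
      b.repr (L x) i = ∑ j, LinearMap.toMatrix b b L i j * b.repr x j :=
    congrFun (LinearMap.toMatrix_mulVec_repr b b L x).symm i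
  intro p
  ext i
  change (⟨b.repr (L p.1) i, b.repr (L p.2) i⟩ : ℂ) =
    ∑ j, (LinearMap.toMatrix b b L i j : ℂ) * ⟨b.repr p.1 j, b.repr p.2 j⟩
  simp only [Complex.ext_iff, Complex.re_sum, Complex.im_sum, Complex.re_ofReal_mul,
    Complex.im_ofReal_mul, hrepr, and_self]

theorem tendsto_log_measureReal_dynamicalBall_exp_smul [MeasurableSpace E] [BorelSpace E]
    (L : E →L[ℝ] E) (μ : Measure E) [μ.IsAddHaarMeasure] {r : ℝ} (hr : 0 < r) :
    Tendsto (fun T => Real.log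
      (μ.real (dynamicalBall (fun t => NormedSpace.exp (t • L)) T r)) / T) atTop
      (𝓝 (-unstableRootSum ((L : E →ₗ[ℝ] E).charpoly.map (algebraMap ℝ ℂ)))) := by
  have := FiniteDimensional.complete ℝ E
  let b := Module.finBasis ℝ E
  have hprod (T : ℝ) :
      dynamicalBall (fun t => NormedSpace.exp (t • L.prodMap L)) T r =
        dynamicalBall (fun t => NormedSpace.exp (t • L)) T r ×ˢ
          dynamicalBall (fun t => NormedSpace.exp (t • L)) T r := by
    rw [← dynamicalBall_prodMap]
    simp only [← exp_prodMap]
    rfl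
  have hdouble := tendsto_log_measureReal_dynamicalBall_of_semiconj
    (complexCoordinates_semiconj b L) (μ.prod μ) hr
  rw [charpoly_toLin'_map_toMatrix] at hdouble
  convert hdouble.div_const 2 using 2 with T
  · rw [hprod, measureReal_prod_prod, ← sq, Real.log_pow, Nat.cast_ofNat]
    ring
  · ring

end Complexification

section Entropy

theorem mainTheorem5_general {E : Type*} [NormedAddCommGroup E] [NormedSpace ℝ E]
    [FiniteDimensional ℝ E] [MeasurableSpace E] [BorelSpace E] (μ : Measure E)
    [μ.IsAddHaarMeasure] (L : E →L[ℝ] E) {φ : ℝ → E → E} (hφ : IsSolutionMap (fun _ => L) φ)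
    {K : Set E} (hK : Bornology.IsBounded K) (hKpos : 0 < μ K) {ε : ℝ} (hε : 0 < ε) :
    Tendsto (fun T : ℝ => ENNReal.log (spanningCard φ K T ε : ENNReal) / (T : EReal)) atTop
      (𝓝 ((unstableRootSum ((L : E →ₗ[ℝ] E).charpoly.map (algebraMap ℝ ℂ)) : ℝ) : EReal)) := by
  have := FiniteDimensional.complete ℝ E
  have : NormedAlgebra ℚ (E →L[ℝ] E) := NormedAlgebra.restrictScalars ℚ ℝ _
  have hflow (t : ℝ) (ht : 0 ≤ t) : φ t = ⇑(NormedSpace.exp (t • L)) := by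
    ext x
    rw [eq_exp_smul_apply_of_hasDerivWithinAt L (hφ x).2 ht, (hφ x).1]
  have hspan (T : ℝ) : spanningCard φ K T ε =
      spanningCard (fun t => ⇑(NormedSpace.exp (t • L))) K T ε :=
    spanningCard_congr fun t ht => hflow t ht.1
  simp only [hspan]
  exact tendsto_log_spanningCard_div (φ := fun t => NormedSpace.exp (t • L)) μ (by simp)
    (NormedSpace.exp_continuous.comp (continuous_id.smul continuous_const)) hK hKpos
    (fun r hr => tendsto_log_measureReal_dynamicalBall_exp_smul L μ hr) hε

theorem unstableEigenvalueSum_eq_unstableRootSum {n : ℕ} (A : Matrix (Fin n) (Fin n) ℝ) :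
    unstableEigenvalueSum A = unstableRootSum (A.mulVecLin.charpoly.map (algebraMap ℝ ℂ)) := by
  rw [Matrix.charpoly_mulVecLin, ← Matrix.charpoly_map]
  rfl

end Entropy

theorem mainTheorem5 {n : ℕ} (A : Matrix (Fin n) (Fin n) ℝ)
    (φ : ℝ → (Fin n → ℝ) → (Fin n → ℝ))
    (hφ : IsSolutionMap (fun _ x => A.mulVec x) φ)
    (K : Set (Fin n → ℝ)) (hK : IsCompact K) (hKpos : 0 < volume K) :
    HasTopologicalEntropy φ K ((unstableEigenvalueSum A : ℝ) : EReal) := by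
  rw [unstableEigenvalueSum_eq_unstableRootSum]
  refine tendsto_const_nhds.congr' ?_
  filter_upwards [self_mem_nhdsWithin] with ε hε
  exact (mainTheorem5_general volume A.mulVecLin.toContinuousLinearMap hφ hK.isBounded hKpos
    hε).limsup_eq.symm
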